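/- Let $\alpha,\beta,\omega,q,A_0,h_l>0$ be real and put $c=\frac{(1+q^2)\omega}{2q}$, $v=\frac{(1-q^2)\omega}{2q}$. Let $h_s$ and $h_g$ be independent real random variables with probability densities $$f_{h_s}(y)=\frac{2(\alpha\beta)^{\frac{\alpha+\beta}{2}}}{\Gamma(\alpha)\Gamma(\beta)}\,y^{\frac{\alpha+\beta}{2}-1}K_{\alpha-\beta}\!\left(2\sqrt{\alpha\beta y}\right)\quad(y>0)$$ (Gamma-Gamma) and $$f_{h_g}(y)=\frac{\omega}{A_0}\left(\frac{y}{A_0}\right)^{c-1}I_0\!\left(-v\ln\frac{y}{A_0}\right)\quad(0<y\le A_0)$$ (pointing errors), both zero elsewhere, where $I_0$ and $K_\nu$ are the modified Bessel functions of the first and second kind. Then $h=h_l h_s h_g$ has the probability density $f_h$ that vanishes on $(-\infty,0]$ and is given for every $x>0$ by the convergent expressions $$f_h(x)=\int_{x/(A_0h_l)}^{\infty}\frac{1}{y h_l}\,f_{h_g}\!\left(\frac{x}{y h_l}\right)f_{h_s}(y)\,dy =\frac{\omega\alpha\beta}{h_lA_0\Gamma(\alpha)\Gamma(\beta)}\sum_{k=0}^{\infty}\binom{2k}{k}\left(\frac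 v2\right)^{2k}G^{2k+3,0}_{2k+1,2k+3}\!\left(\frac{\alpha\beta x}{A_0h_l}\,\middle|\,\begin{array}{c}\{c\}_1^{2k+1}\\ \alpha-1,\ \beta-1,\ \{c-1\}_1^{2k+1}\end{array}\right).$$ Here $\{a\}_1^{N}$ denotes $a$ repeated $N$ times, and the Meijer G-function is the absolutely convergent Mellin-Barnes integral $$G^{2k+3,0}_{2k+1,2k+3}\!\left(z\,\middle|\,\cdots\right)=\frac1{2\pi i}\int_{\psi-i\infty}^{\psi+i\infty}\frac{\Gamma(\alpha-1-s)\,\Gamma(\beta-1-s)\,\Gamma(c-1-s)^{2k+1}}{\Gamma(c-s)^{2k+1}}\,z^s\,ds ,$$ whose value does not depend on the choice of the real number $\psi<\min(\alpha,\beta,c)-1$. -/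

import Mathlib

open MeasureTheory ProbabilityTheory Set

noncomputable section

/-- Modified Bessel function of the first kind of order zero,
`I₀(x) = ∑ₖ (x/2)^(2k) / (k!)²`. -/
def besselI0 (x : ℝ) : ℝ :=
  ∑' k : ℕ, (x / 2) ^ (2 * k) / ((k.factorial : ℝ) ^ 2)

/-- Modified Bessel function of the second kind of real order `ν`, for arguments `x > 0`,
`K_ν(x) = ∫₀^∞ exp(-x cosh t) cosh(ν t) dt`. -/
def besselK (ν x : ℝ) : ℝ :=
  ∫ t in Ioi (0 : ℝ), Real.exp (-x * Real.cosh t) * Real.cosh (ν * t)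

/-- Gamma-Gamma probability density with parameters `α`, `β`, supported on `(0, ∞)`. -/
def gammaGammaPDF (α β x : ℝ) : ℝ :=
  if 0 < x then
    2 * (α * β) ^ ((α + β) / 2) / (Real.Gamma α * Real.Gamma β)
      * x ^ ((α + β) / 2 - 1) * besselK (α - β) (2 * √(α * β * x))
  else 0

/-- Probability density of the pointing-error coefficient, supported on `(0, A₀]`
(the single point `0`, where the formula may be singular, is given the value `0`). -/
def pointingErrorPDF (ω q A₀ x : ℝ) : ℝ :=
  if 0 < x ∧ x ≤ A₀ then
    ω / A₀ * (x / A₀) ^ ((1 + q ^ 2) * ω / (2 * q) - 1)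
      * besselI0 (-((1 - q ^ 2) * ω / (2 * q)) * Real.log (x / A₀))
  else 0

/-- The integrand (in the variable `y`, a value of the turbulence coefficient) of the formula for
the density at `x` of the product channel `h_l * h_s * h_g`. -/
def e2eIntegrand (α β ω q A₀ hl x y : ℝ) : ℝ :=
  1 / (y * hl) * pointingErrorPDF ω q A₀ (x / (y * hl)) * gammaGammaPDF α β y

/-- The density of the end-to-end channel as the integral
`∫_{x/(A₀ h_l)}^∞ (1/(y h_l)) f_{h_g}(x/(y h_l)) f_{h_s}(y) dy`. -/
def e2ePDF (α β ω q A₀ hl x : ℝ) : ℝ :=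
  ∫ y in Ioi (x / (A₀ * hl)), e2eIntegrand α β ω q A₀ hl x y

/-- The real random variable `X` has a law with probability density `f` with respect to Lebesgue
measure on the line. -/
def HasDensity {Ω : Type*} [MeasurableSpace Ω] (P : Measure Ω) (X : Ω → ℝ) (f : ℝ → ℝ) : Prop :=
  AEMeasurable X P ∧ P.map X = volume.withDensity (fun x => ENNReal.ofReal (f x))

/-- The Mellin-Barnes integrand of the Meijer function `G^{m,n}_{p,q}(z | a ; b)`:
`∏_{j ≤ m} Γ(b_j - s) ∏_{j ≤ n} Γ(1 - a_j + s) /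
  (∏_{j > m} Γ(1 - b_j + s) ∏_{j > n} Γ(a_j - s)) * z^s`
(the indices of `a` and `b` start at `0` here). -/
def meijerIntegrand (m n p q : ℕ) (a : Fin p → ℂ) (b : Fin q → ℂ) (z s : ℂ) : ℂ :=
  ((∏ j : Fin q with j.val < m, Complex.Gamma (b j - s))
      * ∏ j : Fin p with j.val < n, Complex.Gamma (1 - a j + s))
    / ((∏ j : Fin q with m ≤ j.val, Complex.Gamma (1 - b j + s))
      * ∏ j : Fin p with n ≤ j.val, Complex.Gamma (a j - s))
    * z ^ s

/-- The vertical line `Re s = ψ` has all poles of the `Γ(b_j - s)`, `j ≤ m`, on its right and all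
poles of the `Γ(1 - a_j + s)`, `j ≤ n`, on its left. -/
def IsMeijerLine (m n p q : ℕ) (a : Fin p → ℂ) (b : Fin q → ℂ) (ψ : ℝ) : Prop :=
  (∀ j : Fin q, (j : ℕ) < m → ψ < (b j).re) ∧ (∀ j : Fin p, (j : ℕ) < n → (a j).re - 1 < ψ)

/-- `(1 / (2πi)) ∫_{ψ-i∞}^{ψ+i∞}` of the Mellin-Barnes integrand, with `s = ψ + i t`. -/
def meijerLineIntegral (m n p q : ℕ) (a : Fin p → ℂ) (b : Fin q → ℂ) (z : ℂ) (ψ : ℝ) : ℂ :=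
  1 / (2 * Real.pi : ℂ) *
    ∫ t : ℝ, meijerIntegrand m n p q a b z ((ψ : ℂ) + (t : ℂ) * Complex.I)

open Classical in
/-- The Meijer function `G^{m,n}_{p,q}(z | a ; b)`, as the Mellin-Barnes integral along a vertical
line from `ψ - i∞` to `ψ + i∞` that separates the two families of poles (the value is `0` if
the parameters admit no such straight line; for `n = 0` one always exists). -/
def meijerG (m n p q : ℕ) (a : Fin p → ℂ) (b : Fin q → ℂ) (z : ℂ) : ℂ :=
  if h : ∃ ψ : ℝ, IsMeijerLine m n p q a b ψ then
    meijerLineIntegral m n p q a b z h.choose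
  else 0

/-- The upper parameters `{c}_1^{2k+1}`. -/
def upperParams (c : ℝ) (k : ℕ) : Fin (2 * k + 1) → ℂ :=
  fun _ => (c : ℂ)

/-- The lower parameters `α - 1, β - 1, {c - 1}_1^{2k+1}`. -/
def lowerParams (α β c : ℝ) (k : ℕ) : Fin (2 * k + 3) → ℂ :=
  fun j => if (j : ℕ) = 0 then (α : ℂ) - 1 else if (j : ℕ) = 1 then (β : ℂ) - 1 else (c : ℂ) - 1

end

/-!
The substitution `y = a exp τ`, `a = x / (A₀ h_l)`, turns the product integral into
`∫_{τ > 0} exp((1-c)τ) I₀(vτ) F(αβ a exp τ) dτ` up to a constant (`e2ePDF_eq`), where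
`F y = 2 y^((α+β)/2-1) K_{α-β}(2√y)` is the Gamma-Gamma density without its normalisation
(`gammaProduct`). Since `(2k)! = choose (2k) k * (k!)^2`, expanding `I₀` gives the series
`∑ choose (2k) k (v/2)^(2k) g_k` with `g_k z = ∫_{τ > 0} exp((1-c)τ) τ^(2k)/(2k)! F(z exp τ) dτ`
(`logPowerConv`, `hasSum_logPowerConv`); all terms are nonnegative, so that dominated convergence
applies with the terms themselves as bounds.

It remains to see that `g_k` is the Meijer function. It is a multiplicative convolution, hence its
Mellin transform is a product (`hasMellin_integral_comp_mul`): the transform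
`Γ(α-1+s) Γ(β-1+s)` of `F`, itself obtained from the representation
`F y = y^(β-1) ∫ t^(α-β-1) exp(-t-y/t) dt`, times the Laplace transform `(c-1+s)^(-(2k+1))` of
the log-power weight. As `Γ(c-1-s)/Γ(c-s) = 1/(c-1-s)`, the Mellin-Barnes integrand is this
transform at `-s`, times `z^s`, and Mellin inversion along any admissible line gives `g_k z`
(`meijer_line`). The inversion needs continuity of `g_k`, which follows from the continuity and rapid decay of `F`,
and integrability on vertical lines, which follows from the quadratic decay of `Γ` that two
applications of its functional equation provide (`norm_Gamma_vertical_le`).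

That the product integral is the density of `h_l h_s h_g` is Tonelli's theorem
(`map_mul_eq_withDensity`).
-/

noncomputable section

/-! ### Mellin transforms of multiplicative convolutions -/

/-- The Mellin transform of `z ↦ ∫ w(x) f(κ(x) z) dμ(x)` is the Mellin transform of `f` times
`∫ w(x) κ(x)^(-s) dμ(x)`, by Fubini. -/
theorem hasMellin_integral_comp_mul {X : Type*} [MeasurableSpace X] {μ : Measure X} [SFinite μ]
    {w : X → ℂ} {κ : X → ℝ} {f : ℝ → ℂ} {s m : ℂ} (hw : Measurable w) (hκ : Measurable κ)
    (hf : Measurable f) (hκpos : ∀ᵐ x ∂μ, 0 < κ x) (hfs : HasMellin f s m)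
    (hint : Integrable (fun x => w x * (κ x : ℂ) ^ (-s)) μ) :
    HasMellin (fun z => ∫ x, w x * f (κ x * z) ∂μ) s ((∫ x, w x * (κ x : ℂ) ^ (-s) ∂μ) * m) := by
  obtain ⟨hfc, hfm⟩ := hfs
  have hmeas : Measurable
      (fun p : X × ℝ => (p.2 : ℂ) ^ (s - 1) * (w p.1 * f (κ p.1 * p.2))) := by
    have h1 : Measurable fun p : X × ℝ => (p.2 : ℂ) ^ (s - 1) :=
      (Complex.measurable_ofReal.comp measurable_snd).pow_const _
    have h2 : Measurable fun p : X × ℝ => f (κ p.1 * p.2) :=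
      hf.comp ((hκ.comp measurable_fst).mul measurable_snd)
    exact h1.mul ((hw.comp measurable_fst).mul h2)
  have hnorm : ∀ x, 0 < κ x → ∫ z in Ioi (0 : ℝ), ‖(z : ℂ) ^ (s - 1) * (w x * f (κ x * z))‖
      = ‖w x * (κ x : ℂ) ^ (-s)‖ * ∫ z in Ioi (0 : ℝ), ‖(z : ℂ) ^ (s - 1) * f z‖ := by
    intro x hx
    have h1 : EqOn (fun z : ℝ => ‖(z : ℂ) ^ (s - 1) * (w x * f (κ x * z))‖)
        (fun z : ℝ => (‖w x‖ * κ x ^ (1 - s.re)) *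
          (fun u : ℝ => ‖(u : ℂ) ^ (s - 1) * f u‖) (κ x * z)) (Ioi 0) := by
      intro z hz
      have hz : 0 < z := hz
      simp only [norm_mul, Complex.norm_cpow_eq_rpow_re_of_pos hz,
        Complex.norm_cpow_eq_rpow_re_of_pos (mul_pos hx hz), Complex.sub_re, Complex.one_re]
      rw [Real.mul_rpow hx.le hz.le, show 1 - s.re = -(s.re - 1) by ring, Real.rpow_neg hx.le]
      have := (Real.rpow_pos_of_pos hx (s.re - 1)).ne'
      field_simp
    rw [setIntegral_congr_fun measurableSet_Ioi h1, integral_const_mul,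
      integral_comp_mul_left_Ioi (fun u : ℝ => ‖(u : ℂ) ^ (s - 1) * f u‖) _ hx, mul_zero, norm_mul,
      Complex.norm_cpow_eq_rpow_re_of_pos hx, Complex.neg_re, smul_eq_mul,
      show 1 - s.re = -s.re + 1 by ring, Real.rpow_add_one hx.ne']
    field_simp
  have hΦ : Integrable (fun p : X × ℝ => (p.2 : ℂ) ^ (s - 1) * (w p.1 * f (κ p.1 * p.2)))
      (μ.prod (volume.restrict (Ioi 0))) := by
    rw [integrable_prod_iff hmeas.aestronglyMeasurable]
    constructor
    · filter_upwards [hκpos] with x hx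
      have := ((MellinConvergent.comp_mul_left hx).2 hfc).const_smul (w x)
      simpa [MellinConvergent, IntegrableOn] using this
    · refine (hint.norm.mul_const (∫ z in Ioi (0 : ℝ), ‖(z : ℂ) ^ (s - 1) * f z‖)).congr ?_
      filter_upwards [hκpos] with x hx using (hnorm x hx).symm
  refine ⟨?_, ?_⟩
  · have := hΦ.integral_prod_right
    simpa [MellinConvergent, IntegrableOn, integral_const_mul] using this
  · have h := integral_integral_swap (μ := μ) (ν := volume.restrict (Ioi (0 : ℝ)))
      (f := fun x z => (z : ℂ) ^ (s - 1) * (w x * f (κ x * z))) hΦ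
    simp only [mellin, smul_eq_mul, ← integral_const_mul]
    rw [← h, ← integral_mul_const]
    refine integral_congr_ae ?_
    filter_upwards [hκpos] with x hx
    have h2 := mellin_comp_mul_left f s hx
    rw [hfm] at h2
    simp only [mellin, smul_eq_mul] at h2
    rw [mul_assoc, ← h2, ← integral_const_mul]
    congr 1
    ext z
    ring

/-! ### The Bessel kernel -/

/-- The integral `∫₀^∞ t^(ν-1) exp(-t - y/t) dt`, which for `y > 0` equals
`2 y^(ν/2) K_ν(2√y)`. -/
def besselKernel (ν y : ℝ) : ℝ :=
  ∫ t in Ioi (0 : ℝ), t ^ (ν - 1) * Real.exp (-t - y / t)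

theorem measurable_besselKernel (ν : ℝ) : Measurable (besselKernel ν) := by
  have h : StronglyMeasurable
      (Function.uncurry fun y t : ℝ => t ^ (ν - 1) * Real.exp (-t - y / t)) := by
    apply Measurable.stronglyMeasurable
    unfold Function.uncurry
    fun_prop
  exact h.integral_prod_right.measurable

theorem besselKernel_nonneg (ν y : ℝ) : 0 ≤ besselKernel ν y :=
  setIntegral_nonneg measurableSet_Ioi fun t ht => by
    have : 0 < t := ht
    positivity

/-- Powers of `y / t` are dominated by `exp (y / t)`. -/
theorem besselKernel_integrand_le (ν : ℝ) (m : ℕ) {y t : ℝ} (hy : 0 < y) (ht : 0 < t) :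
    t ^ (ν - 1) * Real.exp (-t - y / t) ≤
      (m.factorial * y ^ (-(m : ℝ))) * (Real.exp (-t) * t ^ (ν + m - 1)) := by
  have h := Real.pow_div_factorial_le_exp _ (div_pos hy ht).le m
  have hf : (0 : ℝ) < m.factorial := by positivity
  have h2 : Real.exp (-(y / t)) ≤ m.factorial * y ^ (-(m : ℝ)) * t ^ (m : ℝ) := by
    rw [Real.exp_neg, Real.rpow_neg hy.le, Real.rpow_natCast, Real.rpow_natCast]
    rw [div_le_iff₀ hf, div_pow] at h
    have hp := Real.exp_pos (y / t)
    rw [inv_le_iff_one_le_mul₀ hp]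
    have hyp : 0 < y ^ m := by positivity
    have htp : 0 < t ^ m := by positivity
    rw [div_le_iff₀ htp] at h
    calc (1 : ℝ) = (y ^ m)⁻¹ * y ^ m := by field_simp
      _ ≤ (y ^ m)⁻¹ * (Real.exp (y / t) * m.factorial * t ^ m) := by gcongr
      _ = _ := by ring
  rw [sub_eq_add_neg (-t), Real.exp_add, show ν + m - 1 = (ν - 1) + m by ring,
    Real.rpow_add ht]
  calc t ^ (ν - 1) * (Real.exp (-t) * Real.exp (-(y / t)))
      ≤ t ^ (ν - 1) * (Real.exp (-t) * (m.factorial * y ^ (-(m : ℝ)) * t ^ (m : ℝ))) := by gcongr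
    _ = _ := by ring

theorem integrableOn_besselKernel_integrand (ν : ℝ) {y : ℝ} (hy : 0 < y) :
    IntegrableOn (fun t => t ^ (ν - 1) * Real.exp (-t - y / t)) (Ioi 0) := by
  obtain ⟨m, hm⟩ := exists_nat_gt (-ν)
  refine Integrable.mono' ((Real.GammaIntegral_convergent (s := ν + m) (by linarith)).const_mul
    (m.factorial * y ^ (-(m : ℝ)))) (by fun_prop) ?_
  refine (ae_restrict_iff' measurableSet_Ioi).2 (Filter.Eventually.of_forall fun t ht => ?_)
  have ht : 0 < t := ht
  rw [Real.norm_of_nonneg (by positivity)]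
  exact besselKernel_integrand_le ν m hy ht

theorem besselKernel_le (ν : ℝ) (m : ℕ) (hm : 0 < ν + m) {y : ℝ} (hy : 0 < y) :
    besselKernel ν y ≤ (m.factorial * Real.Gamma (ν + m)) * y ^ (-(m : ℝ)) := by
  calc besselKernel ν y ≤ ∫ t in Ioi (0 : ℝ),
        (m.factorial * y ^ (-(m : ℝ))) * (Real.exp (-t) * t ^ (ν + m - 1)) :=
      setIntegral_mono_on (integrableOn_besselKernel_integrand ν hy)
        ((Real.GammaIntegral_convergent hm).const_mul _) measurableSet_Ioi
        fun t ht => besselKernel_integrand_le ν m hy ht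
    _ = _ := by
      rw [integral_const_mul, ← Real.Gamma_eq_integral hm]
      ring

theorem continuousAt_besselKernel (ν : ℝ) {y : ℝ} (hy : 0 < y) :
    ContinuousAt (besselKernel ν) y := by
  refine continuousAt_of_dominated
    (bound := fun t => t ^ (ν - 1) * Real.exp (-t - (y / 2) / t)) ?_ ?_
    (integrableOn_besselKernel_integrand ν (half_pos hy)) ?_
  · exact Filter.Eventually.of_forall fun x => by fun_prop
  · filter_upwards [lt_mem_nhds (half_lt_self hy)] with x hx
    refine (ae_restrict_iff' measurableSet_Ioi).2 (Filter.Eventually.of_forall fun t ht => ?_)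
    have ht : 0 < t := ht
    rw [Real.norm_of_nonneg (by positivity)]
    gcongr
  · exact Filter.Eventually.of_forall fun t => by fun_prop

/-- Substitute `t = √y exp u` and fold the line at `u = 0`. -/
theorem besselKernel_eq_besselK (ν : ℝ) {y : ℝ} (hy : 0 < y) :
    besselKernel ν y = 2 * y ^ (ν / 2) * besselK ν (2 * √y) := by
  have hs : 0 < √y := Real.sqrt_pos.2 hy
  have himg : (fun u : ℝ => √y * Real.exp u) '' univ = Ioi 0 := by
    ext t
    simp only [image_univ, mem_range, mem_Ioi]
    constructor
    · rintro ⟨u, rfl⟩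
      positivity
    · intro ht
      exact ⟨Real.log (t / √y), by rw [Real.exp_log (by positivity)]; field_simp⟩
  have hder : ∀ u ∈ (univ : Set ℝ), HasDerivWithinAt (fun u : ℝ => √y * Real.exp u)
      (√y * Real.exp u) univ u := fun u _ =>
    ((Real.hasDerivAt_exp u).const_mul (√y)).hasDerivWithinAt
  have hinj : InjOn (fun u : ℝ => √y * Real.exp u) univ := fun u _ u' _ h =>
    Real.exp_injective (mul_left_cancel₀ hs.ne' h)
  have hpt : ∀ u : ℝ, |√y * Real.exp u| • ((√y * Real.exp u) ^ (ν - 1) *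
      Real.exp (-(√y * Real.exp u) - y / (√y * Real.exp u))) =
      y ^ (ν / 2) * (Real.exp (ν * u) * Real.exp (-(2 * √y) * Real.cosh u)) := by
    intro u
    have hp : 0 < √y * Real.exp u := by positivity
    have h1 : -(√y * Real.exp u) - y / (√y * Real.exp u) = -(2 * √y) * Real.cosh u := by
      rw [Real.cosh_eq, Real.exp_neg]
      nth_rw 2 [← Real.mul_self_sqrt hy.le]
      field_simp
      ring
    rw [h1, abs_of_pos hp, smul_eq_mul, Real.rpow_sub_one hp.ne',
      Real.mul_rpow hs.le (Real.exp_pos u).le, ← Real.exp_mul, Real.sqrt_eq_rpow,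
      ← Real.rpow_mul hy.le, ← Real.sqrt_eq_rpow, show (1 / 2) * ν = ν / 2 by ring, mul_comm u ν]
    field_simp
  have hint := integrableOn_besselKernel_integrand ν hy
  rw [← himg, integrableOn_image_iff_integrableOn_abs_deriv_smul MeasurableSet.univ hder hinj]
    at hint
  simp only [hpt, integrableOn_univ] at hint
  have hint' : Integrable fun u : ℝ =>
      Real.exp (ν * u) * Real.exp (-(2 * √y) * Real.cosh u) := by
    refine (integrable_const_mul_iff ?_ _).1 hint
    exact (Real.rpow_pos_of_pos hy _).ne'.isUnit
  unfold besselKernel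
  rw [← himg, integral_image_eq_integral_abs_deriv_smul MeasurableSet.univ hder hinj]
  simp only [hpt, setIntegral_univ]
  rw [integral_const_mul, ← integral_add_compl measurableSet_Ioi hint', compl_Ioi,
    mul_comm 2 (y ^ (ν / 2)), mul_assoc]
  congr 1
  unfold besselK
  have hneg := integral_comp_neg_Ioi (0 : ℝ)
    (fun u : ℝ => Real.exp (ν * u) * Real.exp (-(2 * √y) * Real.cosh u))
  rw [neg_zero] at hneg
  rw [← hneg, ← integral_add hint'.integrableOn hint'.comp_neg.integrableOn, ← integral_const_mul]
  congr 1
  ext u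
  simp only [Real.cosh_neg, Real.cosh_eq (ν * u), mul_neg]
  ring

/-- The Mellin transform of `besselKernel ν` is `Γ(s) Γ(s + ν)`: the kernel is a multiplicative
convolution of two exponential weights. -/
theorem hasMellin_besselKernel (ν : ℝ) {s : ℂ} (hs : 0 < s.re) (hsν : 0 < (s + ν).re) :
    HasMellin (fun y => (besselKernel ν y : ℂ)) s (Complex.Gamma s * Complex.Gamma (s + ν)) := by
  have hexp : HasMellin (fun y : ℝ => (Real.exp (-y) : ℂ)) s (Complex.Gamma s) := by
    constructor
    · refine (Complex.GammaIntegral_convergent hs).congr_fun (fun x _ => ?_) measurableSet_Ioi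
      simp only [smul_eq_mul, mul_comm]
    · rw [Complex.Gamma_eq_integral hs]
      refine setIntegral_congr_fun measurableSet_Ioi fun x _ => ?_
      simp only [smul_eq_mul, mul_comm]
  have hweight : ∀ t : ℝ, t ∈ Ioi (0 : ℝ) →
      ((Real.exp (-t) : ℝ) : ℂ) * (t : ℂ) ^ (s + ν - 1) =
      ((t ^ (ν - 1) * Real.exp (-t) : ℝ) : ℂ) * ((t⁻¹ : ℝ) : ℂ) ^ (-s) := by
    intro t ht
    have ht : 0 < t := ht
    have ht0 : (t : ℂ) ≠ 0 := by exact_mod_cast ht.ne'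
    rw [Complex.ofReal_inv, Complex.inv_cpow _ _ (by
      rw [Complex.arg_ofReal_of_nonneg ht.le]; exact Real.pi_pos.ne), ← Complex.cpow_neg, neg_neg,
      Complex.ofReal_mul, Complex.ofReal_cpow ht.le,
      show s + ν - 1 = ((ν - 1 : ℝ) : ℂ) + s by push_cast; ring, Complex.cpow_add _ _ ht0]
    ring
  have h := hasMellin_integral_comp_mul (μ := volume.restrict (Ioi (0 : ℝ)))
    (w := fun t : ℝ => ((t ^ (ν - 1) * Real.exp (-t) : ℝ) : ℂ)) (κ := fun t : ℝ => t⁻¹)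
    (by fun_prop) (by fun_prop) (by fun_prop)
    ((ae_restrict_iff' measurableSet_Ioi).2 (Filter.Eventually.of_forall fun t ht =>
      inv_pos.2 ht)) hexp
    ((Complex.GammaIntegral_convergent hsν).congr_fun hweight measurableSet_Ioi)
  have hfun : (fun y => (besselKernel ν y : ℂ)) = fun z => ∫ t in Ioi (0 : ℝ),
      ((t ^ (ν - 1) * Real.exp (-t) : ℝ) : ℂ) * (Real.exp (-(t⁻¹ * z)) : ℂ) := by
    ext z
    rw [besselKernel, ← integral_complex_ofReal]
    congr 1
    ext t
    rw [← Complex.ofReal_mul, mul_assoc, ← Real.exp_add]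
    congr 4
    ring
  rw [hfun]
  convert h using 1
  rw [mul_comm, Complex.Gamma_eq_integral hsν]
  congr 1
  exact setIntegral_congr_fun measurableSet_Ioi hweight

/-! ### The product of two Gamma densities -/

/-- The function `y^(β-1) ∫₀^∞ t^(α-β-1) exp(-t - y/t) dt = 2 y^((α+β)/2-1) K_{α-β}(2√y)`, which is
the density, up to the factor `Γ(α) Γ(β)`, of the product of two independent Gamma variables. -/
def gammaProduct (α β y : ℝ) : ℝ :=
  y ^ (β - 1) * besselKernel (α - β) y

theorem measurable_gammaProduct (α β : ℝ) : Measurable (gammaProduct α β) :=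
  (measurable_id.pow_const _).mul (measurable_besselKernel _)

theorem gammaProduct_nonneg (α β : ℝ) {y : ℝ} (hy : 0 < y) : 0 ≤ gammaProduct α β y :=
  mul_nonneg (Real.rpow_nonneg hy.le _) (besselKernel_nonneg _ _)

theorem continuousAt_gammaProduct (α β : ℝ) {y : ℝ} (hy : 0 < y) :
    ContinuousAt (gammaProduct α β) y :=
  (Real.continuousAt_rpow_const y _ (Or.inl hy.ne')).mul (continuousAt_besselKernel _ hy)

/-- `gammaProduct` decays at infinity faster than any power. -/
theorem exists_gammaProduct_le (α β r : ℝ) :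
    ∃ ρ, r ≤ ρ ∧ ∃ C, 0 ≤ C ∧ ∀ y, 0 < y → gammaProduct α β y ≤ C * y ^ (-ρ) := by
  obtain ⟨m, hm⟩ := exists_nat_gt (max (β - α) (r + β - 1))
  rw [max_lt_iff] at hm
  refine ⟨m + 1 - β, by linarith, m.factorial * Real.Gamma (α - β + m), ?_, fun y hy => ?_⟩
  · have := Real.Gamma_pos_of_pos (s := α - β + m) (by linarith)
    positivity
  · calc gammaProduct α β y ≤ y ^ (β - 1) *
          ((m.factorial * Real.Gamma (α - β + m)) * y ^ (-(m : ℝ))) := by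
          unfold gammaProduct
          have := besselKernel_le (α - β) m (by linarith) hy
          gcongr
      _ = _ := by
        rw [show -(m + 1 - β) = (β - 1) + (-(m : ℝ)) by ring, Real.rpow_add hy]
        ring

theorem hasMellin_gammaProduct (α β : ℝ) {s : ℂ} (hα : 0 < (α - 1 + s).re)
    (hβ : 0 < (β - 1 + s).re) :
    HasMellin (fun y => (gammaProduct α β y : ℂ)) s
      (Complex.Gamma (α - 1 + s) * Complex.Gamma (β - 1 + s)) := by
  have hs : s + (β - 1) + ((α - β : ℝ) : ℂ) = α - 1 + s := by push_cast; ring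
  have hs' : s + (β - 1) = (β : ℂ) - 1 + s := by ring
  have h := hasMellin_besselKernel (α - β) (s := s + (β - 1)) (by rwa [hs']) (by rwa [hs])
  have heq : EqOn (fun t : ℝ => (t : ℂ) ^ (s - 1) •
      ((t : ℂ) ^ ((β : ℂ) - 1) • (besselKernel (α - β) t : ℂ)))
      (fun t : ℝ => (t : ℂ) ^ (s - 1) • (gammaProduct α β t : ℂ)) (Ioi 0) := by
    intro t ht
    have ht : 0 ≤ t := le_of_lt ht
    simp only [gammaProduct, smul_eq_mul, Complex.ofReal_mul, Complex.ofReal_cpow ht,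
      Complex.ofReal_sub, Complex.ofReal_one]
  refine ⟨(MellinConvergent.cpow_smul.2 h.1).congr_fun heq measurableSet_Ioi, ?_⟩
  rw [mellin, ← setIntegral_congr_fun measurableSet_Ioi heq]
  have h2 := mellin_cpow_smul (fun t : ℝ => (besselKernel (α - β) t : ℂ)) s (β - 1)
  rw [mellin] at h2
  rw [h2, h.2, hs, hs', mul_comm]

theorem gammaGammaPDF_eq {α β y : ℝ} (hα : 0 < α) (hβ : 0 < β) (hy : 0 < y) :
    gammaGammaPDF α β y =
      α * β / (Real.Gamma α * Real.Gamma β) * gammaProduct α β (α * β * y) := by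
  have hab : 0 < α * β := mul_pos hα hβ
  rw [gammaGammaPDF, if_pos hy, gammaProduct, besselKernel_eq_besselK _ (by positivity)]
  have h1 : (α * β * y) ^ (β - 1) * (2 * (α * β * y) ^ ((α - β) / 2) *
      besselK (α - β) (2 * √(α * β * y))) =
      2 * (α * β * y) ^ ((α + β) / 2 - 1) * besselK (α - β) (2 * √(α * β * y)) := by
    rw [show (α + β) / 2 - 1 = (β - 1) + (α - β) / 2 by ring, Real.rpow_add (by positivity)]
    ring
  rw [h1, Real.mul_rpow hab.le hy.le, Real.rpow_sub_one hab.ne']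
  field_simp

theorem measurable_gammaGammaPDF {α β : ℝ} (hα : 0 < α) (hβ : 0 < β) :
    Measurable (gammaGammaPDF α β) := by
  have h : gammaGammaPDF α β = (Ioi (0 : ℝ)).indicator fun y =>
      α * β / (Real.Gamma α * Real.Gamma β) * gammaProduct α β (α * β * y) := by
    ext y
    by_cases hy : 0 < y
    · rw [indicator_of_mem (mem_Ioi.2 hy), gammaGammaPDF_eq hα hβ hy]
    · rw [indicator_of_notMem (by simpa using hy), gammaGammaPDF, if_neg hy]
  rw [h]
  exact (((measurable_gammaProduct α β).comp (measurable_id.const_mul _)).const_mul _).indicator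
    measurableSet_Ioi

/-! ### The Bessel function `I₀` and the two densities -/

theorem choose_mul_factorial_sq (k : ℕ) :
    ((2 * k).choose k : ℝ) * (k.factorial : ℝ) ^ 2 = (2 * k).factorial := by
  have := Nat.choose_mul_factorial_mul_factorial (n := 2 * k) (k := k) (by omega)
  rw [show 2 * k - k = k by omega] at this
  rw [← this]
  push_cast
  ring

/-- Termwise comparison with the series of `cosh`. -/
theorem besselI0_term_le (x : ℝ) (k : ℕ) :
    (x / 2) ^ (2 * k) / ((k.factorial : ℝ) ^ 2) ≤ x ^ (2 * k) / (2 * k).factorial := by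
  have h1 : ((2 * k).choose k : ℝ) ≤ 2 ^ (2 * k) := by exact_mod_cast Nat.choose_le_two_pow _ _
  rw [← choose_mul_factorial_sq, div_pow, div_div]
  have hx : 0 ≤ x ^ (2 * k) := by rw [pow_mul]; positivity
  have hc : 0 < ((2 * k).choose k : ℝ) := by exact_mod_cast Nat.choose_pos (by omega)
  gcongr

theorem hasSum_besselI0 (x : ℝ) :
    HasSum (fun k : ℕ => (x / 2) ^ (2 * k) / ((k.factorial : ℝ) ^ 2)) (besselI0 x) :=
  (Summable.of_nonneg_of_le (fun k => by rw [pow_mul]; positivity) (besselI0_term_le x)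
    (Real.hasSum_cosh x).summable).hasSum

theorem besselI0_nonneg (x : ℝ) : 0 ≤ besselI0 x :=
  tsum_nonneg fun k => by rw [pow_mul]; positivity

theorem besselI0_le_exp_abs (x : ℝ) : besselI0 x ≤ Real.exp |x| :=
  (hasSum_le (besselI0_term_le x) (hasSum_besselI0 x) (Real.hasSum_cosh x)).trans (by
    rw [← Real.cosh_abs, Real.cosh_eq]
    have := Real.exp_le_exp.2 (neg_le_self (abs_nonneg x))
    linarith)

theorem measurable_besselI0 : Measurable besselI0 := by
  refine measurable_of_tendsto_metrizable (f := fun n x =>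
    ∑ k ∈ Finset.range n, (x / 2) ^ (2 * k) / ((k.factorial : ℝ) ^ 2)) (fun n => by fun_prop) ?_
  exact tendsto_pi_nhds.2 fun x => (hasSum_besselI0 x).tendsto_sum_nat

theorem measurable_pointingErrorPDF (ω q A₀ : ℝ) : Measurable (pointingErrorPDF ω q A₀) := by
  unfold pointingErrorPDF
  refine Measurable.ite measurableSet_Ioc ?_ measurable_const
  have := measurable_besselI0.comp
    (((Real.measurable_log.comp (measurable_id.div_const A₀)).const_mul
      (-((1 - q ^ 2) * ω / (2 * q)))))
  exact (by fun_prop : Measurable fun x : ℝ =>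
    ω / A₀ * (x / A₀) ^ ((1 + q ^ 2) * ω / (2 * q) - 1)).mul this

theorem pointingErrorPDF_nonneg {ω q A₀ : ℝ} (hω : 0 < ω) (hA₀ : 0 < A₀) (x : ℝ) :
    0 ≤ pointingErrorPDF ω q A₀ x := by
  unfold pointingErrorPDF
  split_ifs with h
  · have := h.1
    have := besselI0_nonneg (-((1 - q ^ 2) * ω / (2 * q)) * Real.log (x / A₀))
    positivity
  · exact le_rfl

theorem gammaGammaPDF_nonneg {α β : ℝ} (hα : 0 < α) (hβ : 0 < β) (y : ℝ) :
    0 ≤ gammaGammaPDF α β y := by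
  by_cases hy : 0 < y
  · rw [gammaGammaPDF_eq hα hβ hy]
    have := gammaProduct_nonneg α β (y := α * β * y) (by positivity)
    have := Real.Gamma_pos_of_pos hα
    have := Real.Gamma_pos_of_pos hβ
    positivity
  · rw [gammaGammaPDF, if_neg hy]

/-! ### Exponential averages of `gammaProduct` -/

/-- A weight of at most exponential growth is beaten by the decay of `gammaProduct` along
`τ ↦ exp τ * y`, locally uniformly in `y`. -/
theorem exists_exponential_bound_gammaProduct (α β C : ℝ) {w : ℝ → ℝ}
    (hwC : ∀ τ, 0 < τ → |w τ| ≤ Real.exp (C * τ)) {z : ℝ} (hz : 0 < z) :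
    ∃ D, ∀ y, z ≤ y → ∀ τ, 0 < τ →
      ‖w τ * gammaProduct α β (Real.exp τ * y)‖ ≤ D * Real.exp (-1 * τ) := by
  obtain ⟨ρ, hρ, D, hD, h⟩ := exists_gammaProduct_le α β (max (C + 1) 0)
  rw [max_le_iff] at hρ
  refine ⟨D * z ^ (-ρ), fun y hy τ hτ => ?_⟩
  have hy0 : 0 < y := hz.trans_le hy
  have hp : 0 < Real.exp τ * y := by positivity
  rw [norm_mul, Real.norm_eq_abs, Real.norm_of_nonneg (gammaProduct_nonneg α β hp)]
  calc |w τ| * gammaProduct α β (Real.exp τ * y)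
      ≤ Real.exp (C * τ) * (D * (Real.exp τ * z) ^ (-ρ)) := by
        refine mul_le_mul (hwC τ hτ) ((h _ hp).trans ?_) (gammaProduct_nonneg α β hp)
          (Real.exp_pos _).le
        refine mul_le_mul_of_nonneg_left ?_ hD
        refine Real.rpow_le_rpow_of_nonpos (by positivity) (by gcongr) (by linarith)
    _ = D * z ^ (-ρ) * Real.exp ((C - ρ) * τ) := by
        rw [Real.mul_rpow (Real.exp_pos _).le hz.le, ← Real.exp_mul,
          show (C - ρ) * τ = C * τ + τ * -ρ by ring, Real.exp_add]
        ring
    _ ≤ D * z ^ (-ρ) * Real.exp (-1 * τ) := by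
        have : (C - ρ) * τ ≤ -1 * τ := by
          apply mul_le_mul_of_nonneg_right _ hτ.le
          linarith
        gcongr

theorem integrableOn_mul_gammaProduct (α β C : ℝ) {w : ℝ → ℝ} (hw : Measurable w)
    (hwC : ∀ τ, 0 < τ → |w τ| ≤ Real.exp (C * τ)) {z : ℝ} (hz : 0 < z) :
    IntegrableOn (fun τ => w τ * gammaProduct α β (Real.exp τ * z)) (Ioi 0) := by
  obtain ⟨D, h⟩ := exists_exponential_bound_gammaProduct α β C hwC hz
  refine Integrable.mono' ((integrableOn_exp_mul_Ioi (by norm_num : (-1 : ℝ) < 0) 0).const_mul D)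
    (hw.mul ((measurable_gammaProduct α β).comp
      (Real.measurable_exp.mul_const z))).aestronglyMeasurable ?_
  exact (ae_restrict_iff' measurableSet_Ioi).2
    (Filter.Eventually.of_forall fun τ hτ => h z le_rfl τ hτ)

theorem continuousAt_integral_mul_gammaProduct (α β C : ℝ) {w : ℝ → ℝ} (hw : Measurable w)
    (hwC : ∀ τ, 0 < τ → |w τ| ≤ Real.exp (C * τ)) {z : ℝ} (hz : 0 < z) :
    ContinuousAt (fun y => ∫ τ in Ioi (0 : ℝ), w τ * gammaProduct α β (Real.exp τ * y)) z := by
  obtain ⟨D, h⟩ := exists_exponential_bound_gammaProduct α β C hwC (half_pos hz)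
  refine continuousAt_of_dominated (bound := fun τ => D * Real.exp (-1 * τ)) ?_ ?_
    ((integrableOn_exp_mul_Ioi (by norm_num : (-1 : ℝ) < 0) 0).const_mul D) ?_
  · exact Filter.Eventually.of_forall fun y => (hw.mul ((measurable_gammaProduct α β).comp
      (Real.measurable_exp.mul_const y))).aestronglyMeasurable
  · filter_upwards [lt_mem_nhds (half_lt_self hz)] with y hy
    exact (ae_restrict_iff' measurableSet_Ioi).2
      (Filter.Eventually.of_forall fun τ hτ => h y hy.le τ hτ)
  · refine Filter.Eventually.of_forall fun τ => ContinuousAt.mul continuousAt_const ?_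
    exact ContinuousAt.comp' (f := fun y => Real.exp τ * y)
      (continuousAt_gammaProduct α β (by positivity)) (by fun_prop)

/-- The weight `exp((1-c)τ) τ^n / n!`, whose Laplace transform is a power of a linear function. -/
def logPowerWeight (c : ℝ) (n : ℕ) (τ : ℝ) : ℝ :=
  Real.exp ((1 - c) * τ) * (τ ^ n / n.factorial)

theorem measurable_logPowerWeight (c : ℝ) (n : ℕ) : Measurable (logPowerWeight c n) := by
  unfold logPowerWeight
  fun_prop

theorem abs_logPowerWeight_le (c : ℝ) (n : ℕ) (τ : ℝ) (hτ : 0 < τ) :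
    |logPowerWeight c n τ| ≤ Real.exp ((2 - c) * τ) := by
  unfold logPowerWeight
  rw [abs_of_nonneg (by positivity), show (2 - c) * τ = (1 - c) * τ + τ by ring, Real.exp_add]
  gcongr
  exact Real.pow_div_factorial_le_exp _ hτ.le n

/-- The multiplicative convolution of `gammaProduct α β` with the truncated log-power
`(z/y)^(c-1) (log (y/z))^n / n!`, `z < y`, written in the variable `τ = log (y/z)`. -/
def logPowerConv (α β c : ℝ) (n : ℕ) (z : ℝ) : ℝ :=
  ∫ τ in Ioi (0 : ℝ), logPowerWeight c n τ * gammaProduct α β (Real.exp τ * z)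

theorem integrableOn_pow_mul_cexp_neg (n : ℕ) {z : ℂ} (hz : 0 < z.re) :
    IntegrableOn (fun τ : ℝ => (τ : ℂ) ^ n * Complex.exp (-z * τ)) (Ioi 0) := by
  have hint := integrableOn_rpow_mul_exp_neg_mul_rpow (s := n) (p := 1)
    (by linarith [(n.cast_nonneg : (0 : ℝ) ≤ n)]) one_pos hz
  refine Integrable.mono' hint (by fun_prop) ?_
  refine (ae_restrict_iff' measurableSet_Ioi).2 (Filter.Eventually.of_forall fun τ hτ => ?_)
  have hτ : 0 < τ := hτ
  simp [Complex.norm_exp, abs_of_pos hτ]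

/-- For complex `z`; by induction on `n`, integrating the derivative of `τ^(n+1) exp(-zτ)`. -/
theorem integral_pow_mul_cexp_neg (n : ℕ) {z : ℂ} (hz : 0 < z.re) :
    ∫ τ in Ioi (0 : ℝ), (τ : ℂ) ^ n * Complex.exp (-z * τ) = n.factorial / z ^ (n + 1) := by
  have hz0 : z ≠ 0 := fun h => by simp [h] at hz
  induction n with
  | zero =>
    have := integral_exp_mul_complex_Ioi (a := -z) (by simpa using hz) 0
    simpa using this
  | succ n ih =>
    have hd : ∀ τ ∈ Ici (0 : ℝ), HasDerivAt
        (fun τ : ℝ => (τ : ℂ) ^ (n + 1) * Complex.exp (-z * τ))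
        ((n + 1 : ℂ) * ((τ : ℂ) ^ n * Complex.exp (-z * τ)) -
          z * ((τ : ℂ) ^ (n + 1) * Complex.exp (-z * τ))) τ := by
      intro τ _
      have h1 : HasDerivAt (fun τ : ℂ => τ ^ (n + 1) * Complex.exp (-z * τ))
          (((n + 1 : ℕ) : ℂ) * (τ : ℂ) ^ n * Complex.exp (-z * τ) +
            (τ : ℂ) ^ (n + 1) * (Complex.exp (-z * τ) * (-z * 1))) (τ : ℂ) :=
        (hasDerivAt_pow (n + 1) (τ : ℂ)).mul
          (((hasDerivAt_id (τ : ℂ)).const_mul (-z)).cexp)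
      convert h1.comp_ofReal using 1
      push_cast
      ring
    have hi := (integrableOn_pow_mul_cexp_neg n hz).const_mul (n + 1 : ℂ)
    have hi' := (integrableOn_pow_mul_cexp_neg (n + 1) hz).const_mul z
    have ht : Filter.Tendsto (fun τ : ℝ => (τ : ℂ) ^ (n + 1) * Complex.exp (-z * τ))
        Filter.atTop (nhds 0) := by
      rw [tendsto_zero_iff_norm_tendsto_zero]
      refine (tendsto_rpow_mul_exp_neg_mul_atTop_nhds_zero (n + 1 : ℕ) z.re hz).congr' ?_
      filter_upwards [Filter.eventually_gt_atTop 0] with τ hτ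
      rw [Real.rpow_natCast]
      simp [Complex.norm_exp, abs_of_pos hτ]
    have h := integral_Ioi_of_hasDerivAt_of_tendsto' hd (hi.sub hi') ht
    rw [integral_sub hi hi', integral_const_mul, integral_const_mul, ih] at h
    simp only [Complex.ofReal_zero, ne_eq, Nat.add_eq_zero_iff, one_ne_zero, and_false,
      not_false_eq_true, zero_pow, zero_mul, sub_zero, sub_eq_zero] at h
    rw [eq_div_iff (pow_ne_zero _ hz0), pow_succ z (n + 1), ← mul_assoc, mul_right_comm,
      mul_comm _ z, ← h, Nat.factorial_succ]
    push_cast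
    field_simp

theorem hasLaplace_logPowerWeight (c : ℝ) (n : ℕ) {s : ℂ} (hs : 0 < (c - 1 + s).re) :
    IntegrableOn (fun τ : ℝ => (logPowerWeight c n τ : ℂ) * ((Real.exp τ : ℝ) : ℂ) ^ (-s))
      (Ioi 0) ∧
    ∫ τ in Ioi (0 : ℝ), (logPowerWeight c n τ : ℂ) * ((Real.exp τ : ℝ) : ℂ) ^ (-s) =
      (1 / (c - 1 + s)) ^ (n + 1) := by
  have hpt : ∀ τ : ℝ, (logPowerWeight c n τ : ℂ) * ((Real.exp τ : ℝ) : ℂ) ^ (-s) =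
      (1 / (n.factorial : ℂ)) * ((τ : ℂ) ^ n * Complex.exp (-(c - 1 + s) * τ)) := by
    intro τ
    rw [logPowerWeight, Complex.cpow_def_of_ne_zero (by exact_mod_cast (Real.exp_pos τ).ne'),
      ← Complex.ofReal_log (Real.exp_pos τ).le, Real.log_exp]
    push_cast
    rw [show -(c - 1 + s) * (τ : ℂ) = (1 - c) * τ + τ * -s by ring, Complex.exp_add]
    ring
  simp only [hpt]
  refine ⟨(integrableOn_pow_mul_cexp_neg n hs).const_mul _, ?_⟩
  rw [integral_const_mul, integral_pow_mul_cexp_neg n hs, one_div_pow]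
  have : (n.factorial : ℂ) ≠ 0 := by exact_mod_cast n.factorial_ne_zero
  field_simp

theorem hasMellin_logPowerConv (α β c : ℝ) (n : ℕ) {s : ℂ} (hα : 0 < (α - 1 + s).re)
    (hβ : 0 < (β - 1 + s).re) (hc : 0 < (c - 1 + s).re) :
    HasMellin (fun z => (logPowerConv α β c n z : ℂ)) s
      ((1 / (c - 1 + s)) ^ (n + 1) *
        (Complex.Gamma (α - 1 + s) * Complex.Gamma (β - 1 + s))) := by
  obtain ⟨h1, h2⟩ := hasLaplace_logPowerWeight c n hc
  have h := hasMellin_integral_comp_mul (μ := volume.restrict (Ioi (0 : ℝ)))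
    (w := fun τ => (logPowerWeight c n τ : ℂ)) (κ := Real.exp)
    (Complex.measurable_ofReal.comp (measurable_logPowerWeight c n)) Real.measurable_exp
    (Complex.measurable_ofReal.comp (measurable_gammaProduct α β))
    (Filter.Eventually.of_forall Real.exp_pos) (hasMellin_gammaProduct α β hα hβ) h1
  rw [h2] at h
  convert h using 2 with z
  rw [logPowerConv, ← integral_complex_ofReal]
  simp

/-! ### Decay of the Gamma function on vertical lines -/

theorem norm_Gamma_le_Gamma_re {s : ℂ} (hs : 0 < s.re) :
    ‖Complex.Gamma s‖ ≤ Real.Gamma s.re := by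
  rw [Complex.Gamma_eq_integral hs, Real.Gamma_eq_integral hs, Complex.GammaIntegral]
  refine (norm_integral_le_integral_norm _).trans_eq ?_
  refine setIntegral_congr_fun measurableSet_Ioi fun x hx => ?_
  have hx : 0 < x := hx
  simp only [norm_mul, Complex.norm_cpow_eq_rpow_re_of_pos hx, Complex.sub_re, Complex.one_re,
    Complex.norm_real, Real.norm_eq_abs, Real.abs_exp]

/-- Two applications of the functional equation give quadratic decay. -/
theorem norm_Gamma_vertical_le {σ : ℝ} (hσ : 0 < σ) (t : ℝ) :
    ‖Complex.Gamma (σ + t * Complex.I)‖ ≤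
      Real.Gamma (σ + 2) * (max 1 (σ ^ 2)⁻¹ * (1 + t ^ 2)⁻¹) := by
  set s : ℂ := σ + t * Complex.I with hs
  have hre : s.re = σ := by simp [hs]
  have him : s.im = t := by simp [hs]
  have hs0 : s ≠ 0 := fun h => by rw [h] at hre; simp at hre; linarith
  have hs1 : s + 1 ≠ 0 := fun h => by
    have := congrArg Complex.re h
    simp [hre] at this
    linarith
  have hG : Complex.Gamma (s + 2) = (s + 1) * (s * Complex.Gamma s) := by
    rw [← Complex.Gamma_add_one s hs0, ← Complex.Gamma_add_one (s + 1) hs1]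
    congr 1
    ring
  have hle : ‖Complex.Gamma (s + 2)‖ ≤ Real.Gamma (σ + 2) := by
    have := norm_Gamma_le_Gamma_re (s := s + 2) (by simp [hre]; linarith)
    simpa [hre] using this
  rw [hG, norm_mul, norm_mul] at hle
  have hn : ‖s‖ ^ 2 = σ ^ 2 + t ^ 2 := by
    rw [← Complex.normSq_eq_norm_sq, Complex.normSq_apply, hre, him]
    ring
  have hn1 : ‖s‖ ≤ ‖s + 1‖ := by
    refine (sq_le_sq₀ (norm_nonneg _) (norm_nonneg _)).1 ?_
    rw [hn, ← Complex.normSq_eq_norm_sq, Complex.normSq_apply]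
    simp only [Complex.add_re, Complex.add_im, Complex.one_re, Complex.one_im, hre, him]
    nlinarith
  have hσ2 : 0 < σ ^ 2 := by positivity
  have hM : 1 + t ^ 2 ≤ max 1 (σ ^ 2)⁻¹ * (σ ^ 2 + t ^ 2) := by
    have h1 : 1 ≤ max 1 (σ ^ 2)⁻¹ * σ ^ 2 := by
      calc (1 : ℝ) = (σ ^ 2)⁻¹ * σ ^ 2 := by field_simp
        _ ≤ _ := by gcongr; exact le_max_right _ _
    have h2 : t ^ 2 ≤ max 1 (σ ^ 2)⁻¹ * t ^ 2 :=
      le_mul_of_one_le_left (sq_nonneg t) (le_max_left _ _)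
    linarith
  have hkey : (σ ^ 2 + t ^ 2) * ‖Complex.Gamma s‖ ≤ Real.Gamma (σ + 2) := by
    refine le_trans ?_ hle
    rw [← hn, sq, mul_assoc]
    gcongr
  have ht : 0 < 1 + t ^ 2 := by positivity
  rw [← mul_assoc, ← div_eq_mul_inv, le_div_iff₀ ht]
  calc ‖Complex.Gamma s‖ * (1 + t ^ 2)
      ≤ ‖Complex.Gamma s‖ * (max 1 (σ ^ 2)⁻¹ * (σ ^ 2 + t ^ 2)) := by gcongr
    _ = max 1 (σ ^ 2)⁻¹ * ((σ ^ 2 + t ^ 2) * ‖Complex.Gamma s‖) := by ring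
    _ ≤ max 1 (σ ^ 2)⁻¹ * Real.Gamma (σ + 2) := by gcongr
    _ = _ := by ring

theorem continuous_Gamma_vertical {σ : ℝ} (hσ : 0 < σ) :
    Continuous fun t : ℝ => Complex.Gamma (σ + t * Complex.I) := by
  refine continuous_iff_continuousAt.2 fun t => ?_
  refine ContinuousAt.comp' (f := fun t : ℝ => (σ + t * Complex.I : ℂ)) ?_ (by fun_prop)
  refine (Complex.differentiableAt_Gamma _ fun m h => ?_).continuousAt
  have := congrArg Complex.re h
  simp at this
  have : (0 : ℝ) ≤ m := m.cast_nonneg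
  linarith

/-- The Mellin transform of `logPowerConv` is absolutely integrable along vertical lines: one
Gamma factor gives the decay, the other factors are bounded. -/
theorem integrable_mellin_logPowerConv {a b c : ℝ} (ha : 0 < a) (hb : 0 < b) (hc : 0 < c)
    (n : ℕ) :
    Integrable fun t : ℝ => (1 / (c + t * Complex.I)) ^ (n + 1) *
      (Complex.Gamma (a + t * Complex.I) * Complex.Gamma (b + t * Complex.I)) := by
  have hc0 : ∀ t : ℝ, (c + t * Complex.I : ℂ) ≠ 0 := fun t h => by
    have := congrArg Complex.re h
    simp at this
    linarith
  have hG := continuous_Gamma_vertical ha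
  have hG' := continuous_Gamma_vertical hb
  refine Integrable.mono' (g := fun t => (1 / c) ^ (n + 1) *
    ((Real.Gamma (a + 2) * (max 1 (a ^ 2)⁻¹ * (1 + t ^ 2)⁻¹)) * Real.Gamma b)) ?_ ?_ ?_
  · exact (((integrable_inv_one_add_sq.const_mul _).const_mul _).mul_const _).const_mul _
  · refine Continuous.aestronglyMeasurable ?_
    refine Continuous.mul (Continuous.pow (Continuous.div continuous_const (by fun_prop) hc0) _)
      (hG.mul hG')
  · refine Filter.Eventually.of_forall fun t => ?_
    rw [norm_mul, norm_mul, norm_pow, norm_div, norm_one]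
    have h1 : c ≤ ‖(c + t * Complex.I : ℂ)‖ := by
      have := Complex.abs_re_le_norm (c + t * Complex.I : ℂ)
      simp only [Complex.add_re, Complex.ofReal_re, Complex.mul_re, Complex.I_re, mul_zero,
        Complex.ofReal_im, Complex.I_im, mul_one, sub_self, add_zero] at this
      exact (le_abs_self c).trans this
    have h2 := norm_Gamma_vertical_le ha t
    have h3 : ‖Complex.Gamma (b + t * Complex.I)‖ ≤ Real.Gamma b := by
      have := norm_Gamma_le_Gamma_re (s := b + t * Complex.I) (by simpa using hb)
      simpa using this
    gcongr

/-! ### The Meijer functions as multiplicative convolutions -/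

theorem isMeijerLine_iff (α β c : ℝ) (k : ℕ) (ψ : ℝ) :
    IsMeijerLine (2 * k + 3) 0 (2 * k + 1) (2 * k + 3) (upperParams c k) (lowerParams α β c k) ψ ↔
      ψ < α - 1 ∧ ψ < β - 1 ∧ ψ < c - 1 := by
  constructor
  · rintro ⟨h, -⟩
    have h0 := h ⟨0, by omega⟩ (by simp)
    have h1 := h ⟨1, by omega⟩ (by simp)
    have h2 := h ⟨2, by omega⟩ (by simp)
    simp only [lowerParams] at h0 h1 h2
    exact ⟨by simpa using h0, by simpa using h1, by simpa using h2⟩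
  · rintro ⟨h0, h1, h2⟩
    refine ⟨fun j _ => ?_, fun j hj => absurd hj (Nat.not_lt_zero _)⟩
    unfold lowerParams
    split_ifs
    · simpa using h0
    · simpa using h1
    · simpa using h2

theorem meijerIntegrand_eq (α β c : ℝ) (k : ℕ) (z : ℂ) {s : ℂ} (hs : s.re < c - 1) :
    meijerIntegrand (2 * k + 3) 0 (2 * k + 1) (2 * k + 3) (upperParams c k) (lowerParams α β c k)
        z s =
      (1 / (c - 1 - s)) ^ (2 * k + 1) *
        (Complex.Gamma (α - 1 - s) * Complex.Gamma (β - 1 - s)) * z ^ s := by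
  have hre : 0 < (c - 1 - s : ℂ).re := by simpa using hs
  have hne : (c - 1 - s : ℂ) ≠ 0 := fun h => by simp [h] at hre
  have hΓ : Complex.Gamma (c - 1 - s) ≠ 0 := Complex.Gamma_ne_zero_of_re_pos hre
  have h1 : Complex.Gamma (c - s) = (c - 1 - s) * Complex.Gamma (c - 1 - s) := by
    rw [← Complex.Gamma_add_one _ hne]
    congr 1
    ring
  have hlt : ∀ j : Fin (2 * k + 3), (j : ℕ) < 2 * k + 3 := fun j => j.2
  have hnle : ∀ j : Fin (2 * k + 3), ¬ (2 * k + 3 ≤ (j : ℕ)) := fun j => by omega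
  have hb : ∏ j : Fin (2 * k + 3), Complex.Gamma (lowerParams α β c k j - s) =
      Complex.Gamma (α - 1 - s) * (Complex.Gamma (β - 1 - s) *
        Complex.Gamma (c - 1 - s) ^ (2 * k + 1)) := by
    rw [Fin.prod_univ_succ, Fin.prod_univ_succ]
    simp [lowerParams]
  simp only [meijerIntegrand, hlt, hnle, Finset.filter_true, Finset.filter_false, hb,
    Nat.not_lt_zero, Nat.zero_le, Finset.prod_empty, upperParams, Finset.prod_const,
    Finset.card_univ, Fintype.card_fin, Finset.card_empty, pow_zero, mul_one, one_mul]
  rw [h1, one_div_pow, mul_pow]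
  field_simp

/-- Mellin inversion, applied to `logPowerConv` on the line `Re s = -ψ`. -/
theorem meijer_line {α β c : ℝ} (k : ℕ) {ψ z : ℝ} (hz : 0 < z)
    (hψ : IsMeijerLine (2 * k + 3) 0 (2 * k + 1) (2 * k + 3) (upperParams c k)
      (lowerParams α β c k) ψ) :
    Integrable (fun t : ℝ => meijerIntegrand (2 * k + 3) 0 (2 * k + 1) (2 * k + 3)
      (upperParams c k) (lowerParams α β c k) (z : ℂ) ((ψ : ℂ) + (t : ℂ) * Complex.I)) ∧
    meijerLineIntegral (2 * k + 3) 0 (2 * k + 1) (2 * k + 3) (upperParams c k)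
      (lowerParams α β c k) (z : ℂ) ψ = (logPowerConv α β c (2 * k) z : ℂ) := by
  obtain ⟨hα, hβ, hc⟩ := (isMeijerLine_iff α β c k ψ).1 hψ
  set f : ℝ → ℂ := fun z => (logPowerConv α β c (2 * k) z : ℂ) with hf
  have hmellin : ∀ t : ℝ, HasMellin f ((-ψ : ℝ) + t * Complex.I)
      ((1 / ((c - 1 - ψ : ℝ) + t * Complex.I)) ^ (2 * k + 1) *
        (Complex.Gamma ((α - 1 - ψ : ℝ) + t * Complex.I) *
          Complex.Gamma ((β - 1 - ψ : ℝ) + t * Complex.I))) := by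
    intro t
    have h := hasMellin_logPowerConv α β c (2 * k) (s := (-ψ : ℝ) + t * Complex.I)
      (by simp; linarith) (by simp; linarith) (by simp; linarith)
    have hcast : ∀ a : ℝ, ((a - 1 - ψ : ℝ) : ℂ) + t * Complex.I =
        a - 1 + ((-ψ : ℝ) + t * Complex.I) := fun a => by
      push_cast
      ring
    simpa only [hcast] using h
  have hvert : Complex.VerticalIntegrable (mellin f) (-ψ) := by
    refine (integrable_mellin_logPowerConv (a := α - 1 - ψ) (b := β - 1 - ψ) (c := c - 1 - ψ)
      (by linarith) (by linarith) (by linarith) (2 * k)).congr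
      (Filter.Eventually.of_forall fun t => ((hmellin t).2).symm)
  have hconv : MellinConvergent f ((-ψ : ℝ) : ℂ) := by simpa using (hmellin 0).1
  have hcont : ContinuousAt f z := Complex.continuous_ofReal.continuousAt.comp
    (continuousAt_integral_mul_gammaProduct α β (2 - c) (measurable_logPowerWeight c (2 * k))
      (abs_logPowerWeight_le c (2 * k)) hz)
  have hinv := mellinInv_mellin_eq (-ψ) f hz hconv hvert hcont
  have hz0 : (z : ℂ) ≠ 0 := by exact_mod_cast hz.ne'
  -- The substitution `s ↦ -s` turns the Mellin-Barnes integrand into that of Mellin inversion.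
  have hpt : ∀ t : ℝ, meijerIntegrand (2 * k + 3) 0 (2 * k + 1) (2 * k + 3)
      (upperParams c k) (lowerParams α β c k) (z : ℂ) ((ψ : ℂ) + (t : ℂ) * Complex.I) =
      (fun y : ℝ => (z : ℂ) ^ (-(((-ψ : ℝ) : ℂ) + y * Complex.I)) •
        mellin f (((-ψ : ℝ) : ℂ) + y * Complex.I)) (-t) := by
    intro t
    have hm := (hmellin (-t)).2
    rw [meijerIntegrand_eq α β c k z (by simpa using hc)]
    simp only []
    rw [hm, smul_eq_mul, mul_comm]
    congr 2
    · push_cast; ring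
    · congr 2; push_cast; ring
    · congr 2 <;> push_cast <;> ring
  refine ⟨?_, ?_⟩
  · have hbdd : Integrable fun y : ℝ => (z : ℂ) ^ (-(((-ψ : ℝ) : ℂ) + y * Complex.I)) •
        mellin f (((-ψ : ℝ) : ℂ) + y * Complex.I) := by
      refine Integrable.bdd_mul (c := z ^ ψ) hvert ?_ ?_
      · refine Continuous.aestronglyMeasurable ?_
        exact Continuous.const_cpow (by fun_prop) (Or.inl hz0)
      · refine Filter.Eventually.of_forall fun y => ?_
        rw [Complex.norm_cpow_eq_rpow_re_of_pos hz]
        simp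
    exact hbdd.comp_neg.congr (Filter.Eventually.of_forall fun t => (hpt t).symm)
  · rw [meijerLineIntegral]
    simp only [hpt]
    rw [integral_neg_eq_self (fun y : ℝ => (z : ℂ) ^ (-(((-ψ : ℝ) : ℂ) + y * Complex.I)) •
        mellin f (((-ψ : ℝ) : ℂ) + y * Complex.I))]
    rw [mellinInv] at hinv
    rw [show (logPowerConv α β c (2 * k) z : ℂ) = f z from rfl, ← hinv, Complex.real_smul]
    push_cast
    rfl

theorem meijerG_eq (α β c : ℝ) (k : ℕ) {z : ℝ} (hz : 0 < z) :
    meijerG (2 * k + 3) 0 (2 * k + 1) (2 * k + 3) (upperParams c k) (lowerParams α β c k) (z : ℂ) =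
      (logPowerConv α β c (2 * k) z : ℂ) := by
  have hex : ∃ ψ : ℝ, IsMeijerLine (2 * k + 3) 0 (2 * k + 1) (2 * k + 3) (upperParams c k)
      (lowerParams α β c k) ψ := by
    refine ⟨min (α - 1) (min (β - 1) (c - 1)) - 1, (isMeijerLine_iff _ _ _ _ _).2 ?_⟩
    have h1 := min_le_left (α - 1) (min (β - 1) (c - 1))
    have h2 := min_le_right (α - 1) (min (β - 1) (c - 1))
    have h3 := min_le_left (β - 1) (c - 1)
    have h4 := min_le_right (β - 1) (c - 1)
    exact ⟨by linarith, by linarith, by linarith⟩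
  rw [meijerG, dif_pos hex]
  exact (meijer_line k hz hex.choose_spec).2

/-! ### Summation of the series -/

/-- The weight `exp((1-c)τ) I₀(vτ)`: the pointing-error density in the variable
`τ = -log (y / A₀)`, up to a constant. -/
def besselWeight (c v τ : ℝ) : ℝ :=
  Real.exp ((1 - c) * τ) * besselI0 (v * τ)

theorem measurable_besselWeight (c v : ℝ) : Measurable (besselWeight c v) := by
  unfold besselWeight
  exact (by fun_prop : Measurable fun τ : ℝ => Real.exp ((1 - c) * τ)).mul
    (measurable_besselI0.comp (measurable_id.const_mul v))

theorem abs_besselWeight_le (c v τ : ℝ) (hτ : 0 < τ) :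
    |besselWeight c v τ| ≤ Real.exp ((1 - c + |v|) * τ) := by
  have h := besselI0_le_exp_abs (v * τ)
  rw [besselWeight, abs_of_nonneg (mul_nonneg (Real.exp_pos _).le (besselI0_nonneg _)), add_mul,
    Real.exp_add]
  rw [abs_mul, abs_of_pos hτ] at h
  gcongr

/-- `I₀` expanded in the weights `logPowerWeight`; `(2k)! = choose (2k) k * (k!)^2`. -/
theorem hasSum_besselWeight (c v τ : ℝ) :
    HasSum (fun k : ℕ => ((2 * k).choose k : ℝ) * (v / 2) ^ (2 * k) * logPowerWeight c (2 * k) τ)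
      (besselWeight c v τ) := by
  have hterm : ∀ k : ℕ, ((2 * k).choose k : ℝ) * (v / 2) ^ (2 * k) * logPowerWeight c (2 * k) τ =
      Real.exp ((1 - c) * τ) * ((v * τ / 2) ^ (2 * k) / (k.factorial : ℝ) ^ 2) := by
    intro k
    have hk : (k.factorial : ℝ) ≠ 0 := by positivity
    have hc : ((2 * k).choose k : ℝ) ≠ 0 := by exact_mod_cast (Nat.choose_pos (by omega)).ne'
    rw [logPowerWeight, ← choose_mul_factorial_sq, mul_div_right_comm, mul_pow]
    field_simp
  simpa only [besselWeight, hterm] using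
    (hasSum_besselI0 (v * τ)).mul_left (Real.exp ((1 - c) * τ))

theorem hasSum_logPowerConv (α β c v : ℝ) {z : ℝ} (hz : 0 < z) :
    HasSum (fun k : ℕ => ((2 * k).choose k : ℝ) * (v / 2) ^ (2 * k) * logPowerConv α β c (2 * k) z)
      (∫ τ in Ioi (0 : ℝ), besselWeight c v τ * gammaProduct α β (Real.exp τ * z)) := by
  have hsum : ∀ τ, HasSum (fun k : ℕ => ((2 * k).choose k : ℝ) * (v / 2) ^ (2 * k) *
      (logPowerWeight c (2 * k) τ * gammaProduct α β (Real.exp τ * z)))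
      (besselWeight c v τ * gammaProduct α β (Real.exp τ * z)) := fun τ => by
    simpa only [mul_assoc] using (hasSum_besselWeight c v τ).mul_right
      (gammaProduct α β (Real.exp τ * z))
  have h := hasSum_integral_of_dominated_convergence (μ := volume.restrict (Ioi (0 : ℝ)))
    (F := fun (k : ℕ) τ => ((2 * k).choose k : ℝ) * (v / 2) ^ (2 * k) *
      (logPowerWeight c (2 * k) τ * gammaProduct α β (Real.exp τ * z)))
    (f := fun τ => besselWeight c v τ * gammaProduct α β (Real.exp τ * z))
    (fun k τ => ((2 * k).choose k : ℝ) * (v / 2) ^ (2 * k) *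
      (logPowerWeight c (2 * k) τ * gammaProduct α β (Real.exp τ * z)))
    (fun k => (((measurable_logPowerWeight c (2 * k)).mul ((measurable_gammaProduct α β).comp
      (Real.measurable_exp.mul_const z))).const_mul _).aestronglyMeasurable)
    (fun k => (ae_restrict_iff' measurableSet_Ioi).2 (Filter.Eventually.of_forall fun τ hτ => by
      have hτ : 0 < τ := hτ
      have := gammaProduct_nonneg α β (y := Real.exp τ * z) (by positivity)
      refine (Real.norm_of_nonneg ?_).le
      rw [pow_mul, logPowerWeight]
      positivity))
    (Filter.Eventually.of_forall fun τ => (hsum τ).summable)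
    (by
      simp only [(hsum _).tsum_eq]
      exact integrableOn_mul_gammaProduct α β _ (measurable_besselWeight c v)
        (abs_besselWeight_le c v) hz)
    (Filter.Eventually.of_forall hsum)
  simpa only [integral_const_mul, logPowerConv] using h

/-! ### The product integral in logarithmic coordinates -/

/-- The integrand of `e2ePDF`, with the Jacobian, after the substitution `y = x / (A₀ hl) * exp τ`. -/
theorem e2eIntegrand_exp {α β ω q A₀ hl c v x : ℝ}
    (hα : 0 < α) (hβ : 0 < β) (hA₀ : 0 < A₀) (hhl : 0 < hl)
    (hc : c = (1 + q ^ 2) * ω / (2 * q)) (hv : v = (1 - q ^ 2) * ω / (2 * q)) (hx : 0 < x)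
    {τ : ℝ} (hτ : 0 < τ) :
    |x / (A₀ * hl) * Real.exp τ| • e2eIntegrand α β ω q A₀ hl x (x / (A₀ * hl) * Real.exp τ) =
      ω * α * β / (hl * A₀ * Real.Gamma α * Real.Gamma β) *
        (besselWeight c v τ * gammaProduct α β (Real.exp τ * (α * β * (x / (A₀ * hl))))) := by
  have hy : 0 < x / (A₀ * hl) * Real.exp τ := by positivity
  have harg : x / (x / (A₀ * hl) * Real.exp τ * hl) = A₀ * Real.exp (-τ) := by
    rw [Real.exp_neg]
    field_simp
  have hmem : 0 < A₀ * Real.exp (-τ) ∧ A₀ * Real.exp (-τ) ≤ A₀ := by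
    refine ⟨by positivity, mul_le_of_le_one_right hA₀.le ?_⟩
    rw [Real.exp_le_one_iff]
    linarith
  rw [e2eIntegrand, gammaGammaPDF_eq hα hβ hy, harg, pointingErrorPDF, if_pos hmem,
    mul_div_cancel_left₀ _ hA₀.ne', Real.log_exp, ← Real.exp_mul, ← hc, ← hv, besselWeight,
    abs_of_pos hy, smul_eq_mul,
    show α * β * (x / (A₀ * hl) * Real.exp τ) = Real.exp τ * (α * β * (x / (A₀ * hl))) by ring,
    show -τ * (c - 1) = (1 - c) * τ by ring, show -v * -τ = v * τ by ring]
  have := (Real.Gamma_pos_of_pos hα).ne'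
  have := (Real.Gamma_pos_of_pos hβ).ne'
  field_simp

theorem e2ePDF_eq {α β ω q A₀ hl c v x : ℝ}
    (hα : 0 < α) (hβ : 0 < β) (hA₀ : 0 < A₀) (hhl : 0 < hl)
    (hc : c = (1 + q ^ 2) * ω / (2 * q)) (hv : v = (1 - q ^ 2) * ω / (2 * q)) (hx : 0 < x) :
    IntegrableOn (e2eIntegrand α β ω q A₀ hl x) (Ioi (x / (A₀ * hl))) ∧
    e2ePDF α β ω q A₀ hl x = ω * α * β / (hl * A₀ * Real.Gamma α * Real.Gamma β) *
      ∫ τ in Ioi (0 : ℝ),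
        besselWeight c v τ * gammaProduct α β (Real.exp τ * (α * β * (x / (A₀ * hl)))) := by
  set a := x / (A₀ * hl) with ha
  have ha0 : 0 < a := by positivity
  have himg : (fun τ : ℝ => a * Real.exp τ) '' Ioi 0 = Ioi a := by
    ext y
    simp only [mem_image, mem_Ioi]
    constructor
    · rintro ⟨τ, hτ, rfl⟩
      exact lt_mul_of_one_lt_right ha0 (Real.one_lt_exp_iff.2 hτ)
    · intro hy
      have h1 : 1 < y / a := (one_lt_div ha0).2 hy
      exact ⟨Real.log (y / a), Real.log_pos h1, by
        rw [Real.exp_log (by linarith)]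
        field_simp⟩
  have hder : ∀ τ ∈ Ioi (0 : ℝ), HasDerivWithinAt (fun τ : ℝ => a * Real.exp τ)
      (a * Real.exp τ) (Ioi 0) τ := fun τ _ =>
    ((Real.hasDerivAt_exp τ).const_mul a).hasDerivWithinAt
  have hinj : InjOn (fun τ : ℝ => a * Real.exp τ) (Ioi 0) := fun τ _ τ' _ h =>
    Real.exp_injective (mul_left_cancel₀ ha0.ne' h)
  have heq : EqOn (fun τ => |a * Real.exp τ| • e2eIntegrand α β ω q A₀ hl x (a * Real.exp τ))
      (fun τ => ω * α * β / (hl * A₀ * Real.Gamma α * Real.Gamma β) *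
        (besselWeight c v τ * gammaProduct α β (Real.exp τ * (α * β * a)))) (Ioi 0) :=
    fun τ hτ => e2eIntegrand_exp hα hβ hA₀ hhl hc hv hx hτ
  constructor
  · rw [← himg, integrableOn_image_iff_integrableOn_abs_deriv_smul measurableSet_Ioi hder hinj,
      integrableOn_congr_fun heq measurableSet_Ioi]
    exact (integrableOn_mul_gammaProduct α β _ (measurable_besselWeight c v)
      (abs_besselWeight_le c v) (by positivity)).const_mul _
  · rw [e2ePDF, ← ha]
    conv_lhs => rw [← himg]
    rw [integral_image_eq_integral_abs_deriv_smul measurableSet_Ioi hder hinj,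
      setIntegral_congr_fun measurableSet_Ioi heq, integral_const_mul]

/-! ### Densities of products of independent variables -/

/-- The density of `l * X * Y` for independent `X > 0` and `Y` with densities `f` and `g`. -/
theorem map_mul_eq_withDensity {Ω : Type*} [MeasurableSpace Ω] {P : Measure Ω}
    [IsProbabilityMeasure P] {X Y : Ω → ℝ} {f g : ℝ → ℝ} {l : ℝ} (hl : 0 < l)
    (hX : HasDensity P X f) (hY : HasDensity P Y g) (hXY : IndepFun X Y P)
    (hf : Measurable f) (hg : Measurable g) (hf0 : ∀ y, 0 ≤ f y)
    (hfneg : ∀ y ≤ 0, f y = 0) :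
    P.map (fun w => l * X w * Y w) = volume.withDensity
      (fun x => ∫⁻ y, ENNReal.ofReal (1 / (y * l) * g (x / (y * l)) * f y)) := by
  have hT : Measurable fun p : ℝ × ℝ => l * p.1 * p.2 := by fun_prop
  have hscale : ∀ y, 0 < y → ∀ B, MeasurableSet B →
      ENNReal.ofReal (f y) * ∫⁻ u in {u | l * y * u ∈ B}, ENNReal.ofReal (g u) =
        ∫⁻ x in B, ENNReal.ofReal (1 / (y * l) * g (x / (y * l)) * f y) := by
    intro y hy B hB
    have hyl : 0 < y * l := mul_pos hy hl
    have hB' : MeasurableSet {u : ℝ | l * y * u ∈ B} :=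
      (measurable_const_mul (l * y)) hB
    have hm : Measurable fun x => ENNReal.ofReal (g (x / (y * l))) :=
      (hg.comp (measurable_id.div_const _)).ennreal_ofReal
    have h1 : ∫⁻ u in {u | l * y * u ∈ B}, ENNReal.ofReal (g u) =
        ∫⁻ x, B.indicator (fun x => ENNReal.ofReal (g (x / (y * l)))) x
          ∂(Measure.map (fun u => y * l * u) volume) := by
      rw [lintegral_map (hm.indicator hB) (measurable_const_mul _), ← lintegral_indicator hB']
      refine lintegral_congr fun u => ?_
      by_cases hu : l * y * u ∈ B
      · rw [indicator_of_mem (mem_ofPred_eq ▸ hu), mul_comm y l, indicator_of_mem hu,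
          mul_div_cancel_left₀ u (mul_pos hl hy).ne']
      · rw [indicator_of_notMem (mem_ofPred_eq ▸ hu), mul_comm y l, indicator_of_notMem hu]
    rw [h1, Real.map_volume_mul_left hyl.ne', lintegral_smul_measure, lintegral_indicator hB,
      smul_eq_mul, ← mul_assoc, ← lintegral_const_mul _ hm]
    refine lintegral_congr fun x => ?_
    rw [abs_of_pos (inv_pos.2 hyl), ← ENNReal.ofReal_mul (hf0 y),
      ← ENNReal.ofReal_mul (mul_nonneg (hf0 y) (inv_pos.2 hyl).le)]
    congr 1
    ring
  have hmap : P.map (fun w => l * X w * Y w) =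
      ((P.map X).prod (P.map Y)).map (fun p : ℝ × ℝ => l * p.1 * p.2) := by
    rw [← (indepFun_iff_map_prod_eq_prod_map_map hX.1 hY.1).1 hXY,
      AEMeasurable.map_map_of_aemeasurable hT.aemeasurable (hX.1.prodMk hY.1)]
    rfl
  have hprobY : IsProbabilityMeasure (P.map Y) := Measure.isProbabilityMeasure_map hY.1
  ext B hB
  rw [hmap, Measure.map_apply hT hB, Measure.prod_apply (hT hB), hX.2,
    lintegral_withDensity_eq_lintegral_mul _ hf.ennreal_ofReal
      (measurable_measure_prodMk_left (hT hB)), withDensity_apply _ hB,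
    lintegral_lintegral_swap]
  · refine lintegral_congr fun y => ?_
    rcases lt_or_ge 0 y with hy | hy
    · rw [← hscale y hy B hB, Pi.mul_apply, hY.2, withDensity_apply]
      · rfl
      · exact (measurable_const_mul (l * y)) hB
    · simp [hfneg y hy]
  · refine Measurable.aemeasurable (Measurable.ennreal_ofReal ?_)
    refine Measurable.mul (Measurable.mul (by fun_prop) (hg.comp (by fun_prop)))
      (hf.comp measurable_snd)

theorem e2eIntegrand_nonneg {α β ω q A₀ hl : ℝ} (hα : 0 < α) (hβ : 0 < β) (hω : 0 < ω)
    (hA₀ : 0 < A₀) (hhl : 0 < hl) (x y : ℝ) : 0 ≤ e2eIntegrand α β ω q A₀ hl x y := by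
  unfold e2eIntegrand
  rcases lt_or_ge 0 y with hy | hy
  · have := pointingErrorPDF_nonneg (q := q) hω hA₀ (x / (y * hl))
    have := gammaGammaPDF_nonneg hα hβ y
    positivity
  · rw [gammaGammaPDF, if_neg (not_lt.2 hy), mul_zero]

theorem e2eIntegrand_eq_zero_of_nonpos (α β ω q A₀ : ℝ) {hl x : ℝ} (hhl : 0 < hl) (hx : x ≤ 0)
    (y : ℝ) : e2eIntegrand α β ω q A₀ hl x y = 0 := by
  unfold e2eIntegrand
  rcases lt_or_ge 0 y with hy | hy
  · rw [pointingErrorPDF, if_neg, mul_zero, zero_mul]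
    exact fun h => (div_nonpos_of_nonpos_of_nonneg hx (by positivity)).not_gt h.1
  · rw [gammaGammaPDF, if_neg (not_lt.2 hy), mul_zero]

theorem e2eIntegrand_eq_zero_of_lt (α β ω q : ℝ) {A₀ hl x y : ℝ} (hhl : 0 < hl) (hA₀ : 0 < A₀)
    (hy : y < x / (A₀ * hl)) : e2eIntegrand α β ω q A₀ hl x y = 0 := by
  unfold e2eIntegrand
  rcases lt_or_ge 0 y with hy0 | hy0
  · rw [pointingErrorPDF, if_neg, mul_zero, zero_mul]
    intro h
    have h2 := h.2
    rw [div_le_iff₀ (by positivity)] at h2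
    rw [lt_div_iff₀ (by positivity)] at hy
    linarith
  · rw [gammaGammaPDF, if_neg (not_lt.2 hy0), mul_zero]

/-- The integrand vanishes below `x / (A₀ hl)`, so the integral over the whole line is `e2ePDF`. -/
theorem lintegral_e2eIntegrand {α β ω q A₀ hl : ℝ} (hα : 0 < α) (hβ : 0 < β) (hω : 0 < ω)
    (hA₀ : 0 < A₀) (hhl : 0 < hl) (x : ℝ) :
    ∫⁻ y, ENNReal.ofReal (e2eIntegrand α β ω q A₀ hl x y) =
      ENNReal.ofReal (e2ePDF α β ω q A₀ hl x) := by
  rcases lt_or_ge 0 x with hx | hx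
  · rw [e2ePDF, ofReal_integral_eq_lintegral_ofReal
      (e2ePDF_eq hα hβ hA₀ hhl rfl rfl hx).1
      (Filter.Eventually.of_forall (e2eIntegrand_nonneg hα hβ hω hA₀ hhl x)),
      ← setLIntegral_congr Ioi_ae_eq_Ici.symm]
    refine (setLIntegral_eq_of_support_subset fun y hy => ?_).symm
    by_contra hlt
    exact hy (by simp [e2eIntegrand_eq_zero_of_lt α β ω q hhl hA₀ (not_le.1 hlt)])
  · simp [e2ePDF, e2eIntegrand_eq_zero_of_nonpos α β ω q A₀ hhl hx]

end

theorem theorem1 {Ω : Type*} [MeasurableSpace Ω] (P : Measure Ω) [IsProbabilityMeasure P]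
    (α β ω q A₀ hl c v : ℝ)
    (hα : 0 < α) (hβ : 0 < β) (hω : 0 < ω) (hq : 0 < q) (hA₀ : 0 < A₀) (hhl : 0 < hl)
    (hc : c = (1 + q ^ 2) * ω / (2 * q)) (hv : v = (1 - q ^ 2) * ω / (2 * q))
    (hs hg : Ω → ℝ)
    (hs_law : HasDensity P hs (gammaGammaPDF α β))
    (hg_law : HasDensity P hg (pointingErrorPDF ω q A₀))
    (h_indep : IndepFun hs hg P) :
    -- the product channel has the density given by the product integral
    HasDensity P (fun w => hl * hs w * hg w) (e2ePDF α β ω q A₀ hl) ∧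
    (∀ x : ℝ, x ≤ 0 → e2ePDF α β ω q A₀ hl x = 0) ∧
    ∀ x : ℝ, 0 < x →
      -- the product integral converges at every point
      IntegrableOn (e2eIntegrand α β ω q A₀ hl x) (Ioi (x / (A₀ * hl))) ∧
      -- every Meijer function of the series is a convergent integral, whatever the line chosen
      (∀ (k : ℕ) (ψ : ℝ),
        IsMeijerLine (2 * k + 3) 0 (2 * k + 1) (2 * k + 3)
            (upperParams c k) (lowerParams α β c k) ψ →
          Integrable (fun t : ℝ => meijerIntegrand (2 * k + 3) 0 (2 * k + 1) (2 * k + 3)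
            (upperParams c k) (lowerParams α β c k) ((α * β * (x / (A₀ * hl)) : ℝ) : ℂ)
            ((ψ : ℂ) + (t : ℂ) * Complex.I)) ∧
          meijerG (2 * k + 3) 0 (2 * k + 1) (2 * k + 3)
              (upperParams c k) (lowerParams α β c k) ((α * β * (x / (A₀ * hl)) : ℝ) : ℂ) =
            meijerLineIntegral (2 * k + 3) 0 (2 * k + 1) (2 * k + 3)
              (upperParams c k) (lowerParams α β c k)
              ((α * β * (x / (A₀ * hl)) : ℝ) : ℂ) ψ) ∧
      -- the series converges and represents the density
      Summable (fun k : ℕ => ((2 * k).choose k : ℂ) * ((v : ℂ) / 2) ^ (2 * k)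
        * meijerG (2 * k + 3) 0 (2 * k + 1) (2 * k + 3)
            (upperParams c k) (lowerParams α β c k) ((α * β * (x / (A₀ * hl)) : ℝ) : ℂ)) ∧
      ((e2ePDF α β ω q A₀ hl x : ℝ) : ℂ) =
        ((ω * α * β / (hl * A₀ * Real.Gamma α * Real.Gamma β) : ℝ) : ℂ) *
          ∑' k : ℕ, ((2 * k).choose k : ℂ) * ((v : ℂ) / 2) ^ (2 * k)
            * meijerG (2 * k + 3) 0 (2 * k + 1) (2 * k + 3)
                (upperParams c k) (lowerParams α β c k)
                ((α * β * (x / (A₀ * hl)) : ℝ) : ℂ) := by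
  refine ⟨⟨?_, ?_⟩, ?_, ?_⟩
  · exact (hs_law.1.const_mul hl).mul hg_law.1
  · rw [map_mul_eq_withDensity hhl hs_law hg_law h_indep (measurable_gammaGammaPDF hα hβ)
      (measurable_pointingErrorPDF ω q A₀) (gammaGammaPDF_nonneg hα hβ)
      (fun y hy => if_neg (not_lt.2 hy))]
    congr 1
    ext1 x
    exact lintegral_e2eIntegrand hα hβ hω hA₀ hhl x
  · intro x hx
    simp [e2ePDF, e2eIntegrand_eq_zero_of_nonpos α β ω q A₀ hhl hx]
  · intro x hx
    have hz : 0 < α * β * (x / (A₀ * hl)) := by positivity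
    obtain ⟨hint, heq⟩ := e2ePDF_eq hα hβ hA₀ hhl hc hv hx
    have hsum : HasSum (fun k : ℕ => ((2 * k).choose k : ℂ) * ((v : ℂ) / 2) ^ (2 * k) *
        (logPowerConv α β c (2 * k) (α * β * (x / (A₀ * hl))) : ℂ))
        ((∫ τ in Ioi (0 : ℝ), besselWeight c v τ *
          gammaProduct α β (Real.exp τ * (α * β * (x / (A₀ * hl)))) : ℝ) : ℂ) := by
      simpa using Complex.hasSum_ofReal.2 (hasSum_logPowerConv α β c v hz)
    simp only [meijerG_eq α β c _ hz]
    refine ⟨hint, fun k ψ hψ => ?_, hsum.summable, ?_⟩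
    · obtain ⟨h1, h2⟩ := meijer_line k hz hψ
      exact ⟨h1, h2.symm⟩
    · rw [hsum.tsum_eq, heq, Complex.ofReal_mul]
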